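/- An abstract simplicial complex is a triangulation of $S^2$ if it is finite and its geometric realization is homeomorphic to $S^2$; the degree of a vertex is the number of vertices joined to it by an edge. A tetrahedral mesh in $\mathbb{R}^3$ is a (geometric) simplicial complex in $\mathbb{R}^3$ each of whose simplices is a face of a tetrahedron of the complex. The link $\mathrm{Lk}\,u$ of a vertex $u$ consists of all simplices that do not contain $u$ but are faces of simplices that contain $u$, and $u$ is an interior vertex if the underlying space of $\mathrm{Lk}\,u$ is homeomorphic to $S^2$. A triangle is $2$-well-centered if its circumcenter lies in its relative interior, i.e. if it is acute. A triangulation $G$ of $S^2$ permits a $2$-well-centered neighborhood if there exist a tetrahedral mesh $M$ in $\mathbb{R}^3$ and an interior vertex $u$ of $M$ such that $\mathrm{Lk}\,u$ is isomorphic to $G$ as a simplicial complex and all triangles ($2$-simplices) of $M$ incident to $u$ are $2$-well-centered. Theorem. Let $G$ be a triangulation of $S^2$ with $m$ vertices. If $G$ contains a vertex $v_1$ of degree $d(v_1) \ge m-3$, then $G$ does not permit a $2$-well-centered neighborhood. -/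

import Mathlib

namespace WellCentered

/-- Three-dimensional Euclidean space. -/
abbrev E3 : Type := EuclideanSpace ℝ (Fin 3)

section Abstract

variable {V : Type*}

/-- The geometric realization of a finite abstract simplicial complex, in barycentric coordinates:
the points of the standard simplex whose support is contained in a face, with the subspace
topology. -/
def realization [Fintype V] (G : AbstractSimplicialComplex V) : Set (V → ℝ) :=
  {x | x ∈ stdSimplex ℝ V ∧ ∃ s ∈ G.faces, ∀ v, v ∉ s → x v = 0}

/-- A finite simplicial complex is a triangulation of the 2-sphere if its realization is
homeomorphic to the unit sphere of `ℝ³`. -/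
def IsSphereTriangulation [Fintype V] (G : AbstractSimplicialComplex V) : Prop :=
  Nonempty (realization G ≃ₜ Metric.sphere (0 : E3) 1)

/-- The 1-skeleton of a simplicial complex, as a graph. -/
def oneSkeleton (G : AbstractSimplicialComplex V) : SimpleGraph V where
  Adj v w := v ≠ w ∧ ∃ e ∈ G.faces, (e : Set V) = {v, w}
  symm.symm v w h := ⟨h.1.symm, h.2.imp fun _ he => ⟨he.1, he.2.trans (Set.pair_comm v w)⟩⟩
  loopless.irrefl _ h := h.1 rfl

/-- The degree of a vertex: the number of vertices joined to it by an edge. -/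
noncomputable def degree (G : AbstractSimplicialComplex V) (v : V) : ℕ :=
  ((oneSkeleton G).neighborSet v).ncard

end Abstract

/-- The link of `u`: the simplices of the closed star of `u` that do not have `u` as a vertex. -/
def link (M : Geometry.SimplicialComplex ℝ E3) (u : E3) : Geometry.SimplicialComplex ℝ E3 where
  faces := {s | s ∈ M.faces ∧ u ∉ s ∧ ∃ t ∈ M.faces, u ∈ t ∧ s ⊆ t}
  isRelLowerSet_faces := by
    rintro s ⟨hs, hus, t, ht, hut, hst⟩
    exact ⟨M.nonempty_of_mem_faces hs, fun r hrs hr =>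
      ⟨M.down_closed hs hrs hr, fun h => hus (hrs h), t, ht, hut, hrs.trans hst⟩⟩
  indep hs := M.indep hs.1
  inter_subset_convexHull hs ht := M.inter_subset_convexHull hs.1 ht.1

/-- A tetrahedral mesh in `ℝ³`: a simplicial complex in `ℝ³` each of whose simplices is a face of
a tetrahedron of the complex. -/
def IsTetrahedralMesh (M : Geometry.SimplicialComplex ℝ E3) : Prop :=
  ∀ s ∈ M.faces, ∃ t ∈ M.faces, s ⊆ t ∧ t.card = 4

/-- `u` is an interior vertex of `M` if the underlying space of its link is homeomorphic to the
2-sphere. -/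
def IsInteriorVertex (M : Geometry.SimplicialComplex ℝ E3) (u : E3) : Prop :=
  u ∈ M.vertices ∧ Nonempty ((link M u).space ≃ₜ Metric.sphere (0 : E3) 1)

/-- The abstract simplicial complex `G` is isomorphic, as a simplicial complex, to the geometric
complex `L`: there is a bijection between the vertex sets that matches the simplices. -/
def IsIsomorphic {V : Type*} (G : AbstractSimplicialComplex V)
    (L : Geometry.SimplicialComplex ℝ E3) : Prop :=
  ∃ φ : V ≃ L.vertices, ∀ s : Finset V,
    s ∈ G.faces ↔ s.map (φ.toEmbedding.trans (Function.Embedding.subtype _)) ∈ L.faces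

/-- An `n`-simplex is `n`-well-centered if its circumcenter lies in its (relative) interior. -/
def IsWellCentered {n : ℕ} (σ : Affine.Simplex ℝ E3 n) : Prop :=
  σ.circumcenter ∈ σ.interior

/-- All triangles of `M` that have `u` as a vertex are 2-well-centered. -/
def TrianglesWellCenteredAt (M : Geometry.SimplicialComplex ℝ E3) (u : E3) : Prop :=
  ∀ τ : Affine.Simplex ℝ E3 2, (∃ t ∈ M.faces, (t : Set E3) = Set.range τ.points) →
    u ∈ Set.range τ.points → IsWellCentered τ

/-- `G` permits a 2-well-centered neighborhood of a vertex. -/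
def PermitsTwoWellCenteredNeighborhood {V : Type*} (G : AbstractSimplicialComplex V) : Prop :=
  ∃ (M : Geometry.SimplicialComplex ℝ E3) (u : E3),
    IsTetrahedralMesh M ∧ IsInteriorVertex M u ∧ IsIsomorphic G (link M u) ∧
      TrianglesWellCenteredAt M u

end WellCentered

/-!
Place the vertex `u` of the mesh at the origin. If a triangle `u a b` is acute, then `⟪a, b⟫ > 0`
(`inner_pos_of_isWellCentered`); in particular any two vertices of a common simplex of the link of
`u` make an acute angle at `u`.

Let `A` consist of `v₁` and the vertices not joined to `v₁`. The degree hypothesis says that `A` has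
at most three elements, so some direction `d ≠ 0` satisfies `⟪d, a⟫ ≤ 0` for every `a` in `A`
(`exists_ne_zero_forall_inner_nonpos`). The link surrounds `u`, so the ray in direction `d` meets it
in a point `x` (`exists_mem_link_space_of_isInteriorVertex`). Write `x` as a convex combination of
the vertices of a simplex. If a vertex `a` in `A` occurred with positive weight, then `⟪x, a⟫ > 0`
by acuteness within that simplex. So only neighbours of `v₁` occur, and then `⟪x, v₁⟫ > 0`. Either
way the choice of `d` is contradicted (`false_of_card_le_three`).

That the link surrounds `u` is topological. Radial projection from `u` is injective on the link
because the simplices of the mesh meet properly (`eq_of_mem_ray`), so it yields a continuous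
injection of the 2-sphere into itself. Such a map is onto
(`surjective_of_continuous_of_injective`), since otherwise the sphere would embed in the plane,
against the two-dimensional Borsuk–Ulam theorem (`exists_apply_eq_apply_neg`), which is proved by
lifting a map on a hemisphere through the complex exponential.
-/

namespace WellCentered

open Metric
open scoped RealInnerProductSpace

/-! ### Injective self-maps of the 2-sphere -/

/-- The retraction of the complex plane onto the closed unit disc, followed by the parametrization
of the closed upper hemisphere by that disc. Being defined on the whole plane, it can be composed
with the lifting theorem for simply connected spaces directly. -/
noncomputable def hemisphere (z : ℂ) : E3 :=
  !₂[z.re / max 1 ‖z‖, z.im / max 1 ‖z‖, √(1 - (‖z‖ / max 1 ‖z‖) ^ 2)]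

lemma norm_hemisphere (z : ℂ) : ‖hemisphere z‖ = 1 := by
  have hm : 0 < max 1 ‖z‖ := lt_max_of_lt_left one_pos
  have h1 : ‖z‖ / max 1 ‖z‖ ≤ 1 := (div_le_one hm).2 (le_max_right _ _)
  have h0 : 0 ≤ ‖z‖ / max 1 ‖z‖ := by positivity
  have h2 : 0 ≤ 1 - (‖z‖ / max 1 ‖z‖) ^ 2 := by nlinarith
  have h3 : ‖z‖ ^ 2 = z.re ^ 2 + z.im ^ 2 := by
    rw [Complex.sq_norm, Complex.normSq_apply]; ring
  rw [EuclideanSpace.norm_eq, Real.sqrt_eq_one, Fin.sum_univ_three]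
  simp only [hemisphere, Real.norm_eq_abs, sq_abs]
  simp only [Matrix.cons_val_zero, Matrix.cons_val_one, Matrix.cons_val]
  rw [Real.sq_sqrt h2, div_pow, div_pow, div_pow, h3]
  ring

lemma continuous_hemisphere : Continuous hemisphere := by
  have hm : ∀ z : ℂ, max 1 ‖z‖ ≠ 0 := fun z => (lt_max_of_lt_left one_pos).ne'
  unfold hemisphere
  refine (PiLp.continuous_toLp 2 _).comp (continuous_pi fun i => ?_)
  fin_cases i
  · exact Complex.continuous_re.div (by fun_prop) hm
  · exact Complex.continuous_im.div (by fun_prop) hm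
  · exact ((continuous_const.sub ((continuous_norm.div (by fun_prop) hm).pow 2))).sqrt

lemma hemisphere_neg {z : ℂ} (hz : ‖z‖ = 1) : hemisphere (-z) = -hemisphere z := by
  ext i
  fin_cases i <;> simp [hemisphere, hz]

/-- The Borsuk–Ulam theorem in dimension two. If `f x - f (-x)` had no zero, then its restriction
to a hemisphere would have a continuous logarithm; on the equator the values of that logarithm at
antipodal points differ by an odd multiple of `π * I`, yet the difference is an odd function on a
connected set, so its imaginary part vanishes somewhere. -/
theorem exists_apply_eq_apply_neg {f : sphere (0 : E3) 1 → ℂ} (hf : Continuous f) :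
    ∃ x, f x = f (-x) := by
  by_contra! hne
  let φ : ℂ → sphere (0 : E3) 1 := fun z => ⟨hemisphere z, by simp [norm_hemisphere]⟩
  have hφ : Continuous φ := continuous_hemisphere.subtype_mk _
  have hφneg : ∀ z : ℂ, ‖z‖ = 1 → φ (-z) = -φ z := fun z hz =>
    Subtype.ext (hemisphere_neg hz)
  let g : C(ℂ, ℂ) := ⟨fun z => f (φ z) - f (-φ z),
    (hf.comp hφ).sub (hf.comp (continuous_neg.comp hφ))⟩
  have hg : ∀ z, g z ≠ 0 := fun z => sub_ne_zero.2 (hne (φ z))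
  obtain ⟨F, ⟨-, hF⟩, -⟩ := Complex.isCoveringMapOn_exp.existsUnique_continuousMap_lifts
    (a₀ := 0) g (Complex.exp_log (hg 0)) (fun z => hg z)
  have hFg : ∀ z, Complex.exp (F z) = g z := fun z => congrFun hF z
  let t : ℂ → ℝ := fun z => (F (-z) - F z).im
  have ht : Continuous t := by fun_prop
  have hconn : IsPreconnected (sphere (0 : ℂ) 1) := isPreconnected_sphere (by simp) 0 1
  have hneg : t (-1) = -t 1 := by simp [t]
  obtain ⟨z, hz, htz⟩ : ∃ z ∈ sphere (0 : ℂ) 1, t z = 0 := by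
    rcases le_total (t 1) 0 with h | h
    · exact hconn.intermediate_value (a := 1) (b := -1) (by simp) (by simp) ht.continuousOn
        ⟨h, by linarith⟩
    · exact hconn.intermediate_value (a := -1) (b := 1) (by simp) (by simp) ht.continuousOn
        ⟨by linarith, h⟩
  have hz1 : ‖z‖ = 1 := by simpa using hz
  have hodd : g (-z) = -g z := by
    change f (φ (-z)) - f (-φ (-z)) = -(f (φ z) - f (-φ z))
    rw [hφneg z hz1, neg_neg, neg_sub]
  have hexp : Complex.exp (F (-z) - F z) = -1 := by
    rw [Complex.exp_sub, hFg, hFg, hodd, neg_div, div_self (hg z)]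
  have hre := congrArg Complex.re hexp
  rw [Complex.exp_re, show (F (-z) - F z).im = 0 from htz, Real.cos_zero, mul_one] at hre
  have := Real.exp_pos (F (-z) - F z).re
  rw [hre] at this
  norm_num at this

/-- A map of the sphere into itself that misses a point is, by stereographic projection, a map to
the plane, and so identifies a pair of antipodal points. -/
theorem surjective_of_continuous_of_injective {g : sphere (0 : E3) 1 → sphere (0 : E3) 1}
    (hg : Continuous g) (hinj : Function.Injective g) : Function.Surjective g := by
  intro p
  by_contra! hp
  have : Fact (Module.finrank ℝ E3 = 2 + 1) := ⟨by simp⟩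
  let σ := stereographic' 2 p
  have hmem : ∀ x, g x ∈ σ.source := fun x => by
    rw [stereographic'_source]; exact hp x
  let e : EuclideanSpace ℝ (Fin 2) ≃L[ℝ] ℂ :=
    ContinuousLinearEquiv.ofFinrankEq (by simp)
  have hcont : Continuous fun x => e (σ (g x)) :=
    e.continuous.comp (σ.continuousOn.comp_continuous hg hmem)
  obtain ⟨x, hx⟩ := exists_apply_eq_apply_neg hcont
  exact ne_neg_of_mem_unit_sphere ℝ x (hinj (σ.injOn (hmem _) (hmem _) (e.injective hx)))

/-! ### Acute triangles -/

/-- In a triangle with circumcenter in its interior, the angle at the first vertex is acute. -/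
lemma inner_pos_of_isWellCentered {τ : Affine.Simplex ℝ E3 2} (h : IsWellCentered τ) :
    0 < ⟪τ.points 1 - τ.points 0, τ.points 2 - τ.points 0⟫ := by
  obtain ⟨w, hw, hw01, hc⟩ := h
  set a := τ.points 1 - τ.points 0 with ha
  set b := τ.points 2 - τ.points 0 with hb
  have hcu : τ.circumcenter - τ.points 0 = w 1 • a + w 2 • b := by
    rw [← hc, Finset.affineCombination_eq_linear_combination _ _ _ hw, Fin.sum_univ_three, ha, hb]
    rw [Fin.sum_univ_three] at hw
    have h0 : w 0 = 1 - w 1 - w 2 := by linarith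
    rw [h0]
    module
  have hr : ∀ i, ‖τ.points i - τ.circumcenter‖ = τ.circumradius := fun i => by
    rw [← dist_eq_norm]; exact τ.dist_circumcenter_eq_circumradius i
  have key : ∀ x : E3, ‖τ.points 0 + x - τ.circumcenter‖ = τ.circumradius →
      2 * ⟪w 1 • a + w 2 • b, x⟫ = ⟪x, x⟫ := by
    intro x hx
    have h1 : ‖x - (w 1 • a + w 2 • b)‖ = ‖w 1 • a + w 2 • b‖ := by
      rw [← hcu, norm_sub_rev _ (τ.points 0), hr 0, ← hx]
      congr 1; abel
    have h2 := norm_sub_sq_real x (w 1 • a + w 2 • b)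
    rw [h1, real_inner_comm] at h2
    rw [real_inner_self_eq_norm_sq]
    linarith
  have h1 := key a (by rw [ha, add_sub_cancel]; exact hr 1)
  have h2 := key b (by rw [hb, add_sub_cancel]; exact hr 2)
  simp only [inner_add_left, inner_smul_left, RCLike.conj_to_real] at h1 h2
  rw [real_inner_comm a b] at h1
  have ha0 : a ≠ 0 := sub_ne_zero.2 (τ.independent.injective.ne (by decide))
  have hb0 : b ≠ 0 := sub_ne_zero.2 (τ.independent.injective.ne (by decide))
  have hA : 0 < ⟪a, a⟫ := real_inner_self_pos.2 ha0
  have hB : 0 < ⟪b, b⟫ := real_inner_self_pos.2 hb0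
  rw [Fin.sum_univ_three] at hw
  have p0 := (hw01 0).1
  have p1 := (hw01 1).1
  have p2 := (hw01 2).1
  by_contra! hP
  -- An obtuse or right angle would give the two other vertices weights at least `1 / 2` each.
  have q1 : 1 / 2 ≤ w 1 := by
    by_contra! hlt
    nlinarith [mul_pos hA (sub_pos.2 hlt), mul_nonneg p2.le (neg_nonneg.2 hP)]
  have q2 : 1 / 2 ≤ w 2 := by
    by_contra! hlt
    nlinarith [mul_pos hB (sub_pos.2 hlt), mul_nonneg p1.le (neg_nonneg.2 hP)]
  linarith

lemma inner_pos_of_pair_mem_link {M : Geometry.SimplicialComplex ℝ E3} {u a b : E3}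
    (hM : TrianglesWellCenteredAt M u) {s : Finset E3} (hs : s ∈ (link M u).faces)
    (ha : a ∈ s) (hb : b ∈ s) : 0 < ⟪a - u, b - u⟫ := by
  classical
  obtain ⟨-, hus, t, ht, hut, hst⟩ := hs
  have hau : a ≠ u := fun h => hus (h ▸ ha)
  have hbu : b ≠ u := fun h => hus (h ▸ hb)
  rcases eq_or_ne a b with rfl | hab
  · exact real_inner_self_pos.2 (sub_ne_zero.2 hau)
  have hr : Set.range ![u, a, b] = {u, a, b} := by
    ext x
    simp [eq_comm]
    tauto
  have hsub : ({u, a, b} : Finset E3) ⊆ t := by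
    intro x hx
    simp only [Finset.mem_insert, Finset.mem_singleton] at hx
    rcases hx with rfl | rfl | rfl
    exacts [hut, hst ha, hst hb]
  have hinj : Function.Injective ![u, a, b] := by
    intro i j hij
    fin_cases i <;> fin_cases j <;> simp_all [eq_comm]
  have hind : AffineIndependent ℝ ![u, a, b] := by
    refine AffineIndependent.of_set_of_injective ?_ hinj
    rw [hr]
    refine (M.indep ht).mono (s := {u, a, b}) ?_
    simpa [Set.insert_subset_iff, Finset.insert_subset_iff] using hsub
  have hwc := hM ⟨![u, a, b], hind⟩ ⟨{u, a, b}, M.down_closed ht hsub (by simp), by simp [hr]⟩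
    ⟨0, rfl⟩
  exact inner_pos_of_isWellCentered hwc

/-! ### The link seen from its vertex -/

lemma notMem_affineSpan_of_mem_link {M : Geometry.SimplicialComplex ℝ E3} {u : E3} {s : Finset E3}
    (hs : s ∈ (link M u).faces) : u ∉ affineSpan ℝ (s : Set E3) := by
  obtain ⟨-, hus, t, ht, hut, hst⟩ := hs
  have := (M.indep ht).notMem_affineSpan_sdiff ⟨u, hut⟩ Set.univ
  intro h
  refine this (affineSpan_mono ℝ ?_ h)
  intro x hx
  refine ⟨⟨x, hst hx⟩, ⟨trivial, fun h => hus ?_⟩, rfl⟩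
  have hxu : x = u := congrArg Subtype.val h
  exact hxu ▸ hx

/-- A ray from `u` meets the link of `u` at most once: the nearer of two such points would lie in
the relative interior of the join of `u` with the simplex of the farther one, and also in a simplex
that does not contain `u`. -/
lemma eq_of_mem_ray {M : Geometry.SimplicialComplex ℝ E3} {u x y : E3} {c : ℝ}
    (hx : x ∈ (link M u).space) (hy : y ∈ (link M u).space) (hc0 : 0 ≤ c) (hc1 : c ≤ 1)
    (h : x - u = c • (y - u)) : x = y := by
  classical
  obtain ⟨s, hs, hxs⟩ := Geometry.SimplicialComplex.mem_space_iff.1 hx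
  obtain ⟨s', hs', hys'⟩ := Geometry.SimplicialComplex.mem_space_iff.1 hy
  obtain ⟨hsM, hus, -⟩ := id hs
  obtain ⟨-, hus', t, ht, hut, hst⟩ := id hs'
  have hcone : insert u s' ∈ M.faces :=
    M.down_closed ht (Finset.insert_subset hut hst) (Finset.insert_nonempty _ _)
  have hxe : x = (1 - c) • u + c • y := by
    rw [← sub_add_cancel x u, h]; module
  have hxcone : x ∈ convexHull ℝ (↑(insert u s') : Set E3) := by
    rw [hxe]
    refine convex_convexHull ℝ _ (subset_convexHull ℝ _ (by simp))
      (convexHull_mono (by simp) hys') (by linarith) hc0 (by ring)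
  have hxs' : x ∈ convexHull ℝ (s' : Set E3) := by
    refine convexHull_mono ?_ (M.inter_subset_convexHull hsM hcone ⟨hxs, hxcone⟩)
    rintro z ⟨hz, hz'⟩
    rcases Finset.mem_insert.1 (Finset.mem_coe.1 hz') with rfl | hz'
    exacts [absurd hz hus, hz']
  by_contra hne
  have hc : c ≠ 1 := by
    rintro rfl
    exact hne (by simpa using h)
  have hc' : 1 - c ≠ 0 := sub_ne_zero.2 (Ne.symm hc)
  refine notMem_affineSpan_of_mem_link hs' ?_
  have hu : u = AffineMap.lineMap y x (1 - c)⁻¹ := by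
    rw [AffineMap.lineMap_apply_module, hxe, smul_add, smul_smul, smul_smul, inv_mul_cancel₀ hc']
    match_scalars <;> field_simp
    ring
  rw [hu]
  exact AffineMap.lineMap_mem _ (convexHull_subset_affineSpan _ hys')
    (convexHull_subset_affineSpan _ hxs')

/-- Seen from an interior vertex, the link fills all directions: radial projection is a continuous
injection of a topological sphere into the unit sphere, hence onto. -/
theorem exists_mem_link_space_of_isInteriorVertex {M : Geometry.SimplicialComplex ℝ E3} {u : E3}
    (hu : IsInteriorVertex M u) {d : E3} (hd : d ≠ 0) :
    ∃ x ∈ (link M u).space, ∃ c : ℝ, 0 < c ∧ x - u = c • d := by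
  obtain ⟨-, ⟨e⟩⟩ := hu
  have hne : ∀ x ∈ (link M u).space, x - u ≠ 0 := by
    intro x hx h
    obtain ⟨s, hs, hxs⟩ := Geometry.SimplicialComplex.mem_space_iff.1 hx
    rw [sub_eq_zero.1 h] at hxs
    exact notMem_affineSpan_of_mem_link hs (convexHull_subset_affineSpan _ hxs)
  let ρ : (link M u).space → sphere (0 : E3) 1 := fun x =>
    ⟨‖(x : E3) - u‖⁻¹ • ((x : E3) - u), by
      simpa using norm_smul_inv_norm (𝕜 := ℝ) (hne x x.2)⟩
  have hρ : Continuous ρ := by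
    refine Continuous.subtype_mk ?_ _
    have h1 : Continuous fun x : (link M u).space => (x : E3) - u := by fun_prop
    exact (h1.norm.inv₀ fun x => norm_ne_zero_iff.2 (hne x x.2)).smul h1
  have hρinj : Function.Injective ρ := by
    intro x y hxy
    have hxy' : ‖(x : E3) - u‖⁻¹ • ((x : E3) - u) = ‖(y : E3) - u‖⁻¹ • ((y : E3) - u) :=
      congrArg Subtype.val hxy
    wlog hle : ‖(x : E3) - u‖ ≤ ‖(y : E3) - u‖ generalizing x y
    · exact (this hxy.symm hxy'.symm (le_of_not_ge hle)).symm
    have hx0 : ‖(x : E3) - u‖ ≠ 0 := norm_ne_zero_iff.2 (hne x x.2)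
    have hy0 : 0 < ‖(y : E3) - u‖ := norm_pos_iff.2 (hne y y.2)
    refine Subtype.ext (eq_of_mem_ray (c := ‖(x : E3) - u‖ / ‖(y : E3) - u‖) x.2 y.2
      (by positivity) ((div_le_one hy0).2 hle) ?_)
    rw [div_eq_mul_inv, mul_smul, ← hxy', smul_smul, mul_inv_cancel₀ hx0, one_smul]
  have hsurj := surjective_of_continuous_of_injective (hρ.comp e.symm.continuous)
    (hρinj.comp e.symm.injective)
  have hd' : 0 < ‖d‖ := norm_pos_iff.2 hd
  obtain ⟨p, hp⟩ := hsurj ⟨‖d‖⁻¹ • d, by simpa using norm_smul_inv_norm (𝕜 := ℝ) hd⟩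
  set x := e.symm p
  have hx : ‖(x : E3) - u‖⁻¹ • ((x : E3) - u) = ‖d‖⁻¹ • d := congrArg Subtype.val hp
  have hx0 : 0 < ‖(x : E3) - u‖ := norm_pos_iff.2 (hne x x.2)
  refine ⟨x, x.2, ‖(x : E3) - u‖ * ‖d‖⁻¹, by positivity, ?_⟩
  rw [mul_smul, ← hx, smul_smul, mul_inv_cancel₀ hx0.ne', one_smul]

/-- At most three vectors of `ℝ³` have a common nonzero vector in their closed polar half-spaces. -/
lemma exists_ne_zero_forall_inner_nonpos {ι : Type*} [Fintype ι] (hι : Fintype.card ι ≤ 3)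
    (a : ι → E3) : ∃ d : E3, d ≠ 0 ∧ ∀ i, ⟪d, a i⟫ ≤ 0 := by
  rcases isEmpty_or_nonempty ι with h | ⟨⟨i₀⟩⟩
  · obtain ⟨d, hd⟩ := exists_ne (0 : E3)
    exact ⟨d, hd, fun i => isEmptyElim i⟩
  let T : E3 →ₗ[ℝ] ι → ℝ := LinearMap.pi fun i => (innerₗ E3).flip (a i)
  have hT : ∀ d i, T d i = ⟪d, a i⟫ := fun d i => rfl
  by_cases hinj : Function.Injective T
  · have hle := LinearMap.finrank_le_finrank_of_injective hinj
    have hfr : Module.finrank ℝ E3 = Module.finrank ℝ (ι → ℝ) := by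
      refine le_antisymm hle ?_
      simpa using hι
    obtain ⟨d, hd⟩ := (LinearMap.injective_iff_surjective_of_finrank_eq_finrank hfr).1 hinj
      fun _ => -1
    refine ⟨d, ?_, fun i => ?_⟩
    · rintro rfl
      have := congrFun hd i₀
      simp at this
    · rw [← hT, hd]; norm_num
  · rw [← LinearMap.ker_eq_bot] at hinj
    obtain ⟨d, hd, hd0⟩ := (Submodule.ne_bot_iff _).1 hinj
    refine ⟨d, hd0, fun i => ?_⟩
    rw [← hT, LinearMap.mem_ker.1 hd]; simp

/-- If the triangles at an interior vertex `u` are acute, then no point `v` of a family `a` of at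
most three points can share a simplex of the link with each link vertex outside the family: a
direction making no acute angle with the family would be covered neither by the simplices that use
a member of the family nor by those whose vertices are all joined to `v`. -/
theorem false_of_card_le_three {M : Geometry.SimplicialComplex ℝ E3} {u v : E3}
    (hu : IsInteriorVertex M u) (hM : TrianglesWellCenteredAt M u) {ι : Type*} [Fintype ι]
    (hι : Fintype.card ι ≤ 3) (a : ι → E3) (hv : v ∈ Set.range a)
    (hadj : ∀ w ∈ (link M u).vertices, w ∉ Set.range a →
      ∃ s ∈ (link M u).faces, v ∈ s ∧ w ∈ s) : False := by
  obtain ⟨d, hd0, hd⟩ := exists_ne_zero_forall_inner_nonpos hι fun i => a i - u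
  obtain ⟨x, hx, c, hc, hxd⟩ := exists_mem_link_space_of_isInteriorVertex hu hd0
  obtain ⟨s, hs, hxs⟩ := Geometry.SimplicialComplex.mem_space_iff.1 hx
  obtain ⟨w, hw0, hw1, hwx⟩ := Finset.mem_convexHull'.1 hxs
  have hexp : ∀ z : E3, ⟪x - u, z⟫ = ∑ b ∈ s, w b * ⟪b - u, z⟫ := by
    intro z
    have : x - u = ∑ b ∈ s, w b • (b - u) := by
      simp_rw [smul_sub, Finset.sum_sub_distrib, ← Finset.sum_smul, hw1, one_smul, hwx]
    rw [this, sum_inner]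
    simp_rw [real_inner_smul_left]
  have hnonpos : ∀ i, ⟪x - u, a i - u⟫ ≤ 0 := fun i => by
    rw [hxd, real_inner_smul_left]
    exact mul_nonpos_of_nonneg_of_nonpos hc.le (hd i)
  -- Vertices of a common simplex make acute angles at `u`, so no point of the family
  -- carries a positive weight in `x`.
  have hsupp : ∀ b ∈ s, 0 < w b → b ∉ Set.range a := by
    rintro _ hb hwb ⟨i, rfl⟩
    refine (hnonpos i).not_gt ?_
    rw [hexp]
    exact Finset.sum_pos' (fun b' hb' => mul_nonneg (hw0 b' hb')
      (inner_pos_of_pair_mem_link hM hs hb' hb).le)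
      ⟨a i, hb, mul_pos hwb (inner_pos_of_pair_mem_link hM hs hb hb)⟩
  -- Hence `x` is a combination of vertices joined to `v`, which all make acute angles with `v`.
  obtain ⟨i, rfl⟩ := hv
  refine (hnonpos i).not_gt ?_
  have hterm : ∀ b ∈ s, 0 < w b → 0 < w b * ⟪b - u, a i - u⟫ := by
    intro b hb hwb
    obtain ⟨s', hs', hv', hb'⟩ := hadj b
      ((link M u).down_closed hs (Finset.singleton_subset_iff.2 hb) (by simp)) (hsupp b hb hwb)
    exact mul_pos hwb (inner_pos_of_pair_mem_link hM hs' hb' hv')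
  rw [hexp]
  refine Finset.sum_pos' (fun b hb => ?_) ?_
  · rcases (hw0 b hb).eq_or_lt with h | h
    · rw [← h, zero_mul]
    · exact (hterm b hb h).le
  · obtain ⟨b, hb, hwb⟩ : ∃ b ∈ s, 0 < w b := by
      by_contra! h
      have := Finset.sum_nonpos h
      linarith
    exact ⟨b, hb, hterm b hb hwb⟩

end WellCentered

theorem mainTheorem2 {V : Type*} [Fintype V] (G : AbstractSimplicialComplex V)
    (hG : WellCentered.IsSphereTriangulation G) (v₁ : V)
    (hv₁ : (Fintype.card V : ℤ) - 3 ≤ (WellCentered.degree G v₁ : ℤ)) :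
    ¬ WellCentered.PermitsTwoWellCenteredNeighborhood G := by
  classical
  rintro ⟨M, u, -, hu, ⟨φ, hφ⟩, hM⟩
  let A : Set V := ((WellCentered.oneSkeleton G).neighborSet v₁)ᶜ
  have hcard : Fintype.card A ≤ 3 := by
    have h := Set.ncard_add_ncard_compl ((WellCentered.oneSkeleton G).neighborSet v₁)
    rw [Nat.card_eq_fintype_card] at h
    rw [← Nat.card_eq_fintype_card, Nat.card_coe_set_eq]
    change _ - 3 ≤ (((WellCentered.oneSkeleton G).neighborSet v₁).ncard : ℤ) at hv₁
    change ((WellCentered.oneSkeleton G).neighborSet v₁)ᶜ.ncard ≤ 3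
    omega
  refine WellCentered.false_of_card_le_three (v := φ v₁) hu hM hcard
    (fun b : A => (φ b : WellCentered.E3)) ⟨⟨v₁, by simp [A]⟩, rfl⟩ ?_
  intro w hw hwA
  obtain ⟨b, hb⟩ := φ.surjective ⟨w, hw⟩
  have hbw : (φ b : WellCentered.E3) = w := congrArg Subtype.val hb
  have hbA : b ∈ (WellCentered.oneSkeleton G).neighborSet v₁ := by
    by_contra hbA
    exact hwA ⟨⟨b, hbA⟩, hbw⟩
  obtain ⟨-, s, hs, hse⟩ := hbA
  have h1 : v₁ ∈ s := by rw [← Finset.mem_coe, hse]; simp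
  have h2 : b ∈ s := by rw [← Finset.mem_coe, hse]; simp
  exact ⟨_, (hφ s).1 hs, Finset.mem_map.2 ⟨v₁, h1, rfl⟩, Finset.mem_map.2 ⟨b, h2, hbw⟩⟩
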